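/- Let $d\ge 1$ and $n\ge 1$ be integers and let $V$ be a $d\times d$ real positive semi-definite matrix all of whose diagonal entries equal $1$. For a centered random vector $Z$ with $E\|Z\|^2<\infty$ write $\mathrm{cov}(Z)=E(ZZ^T)$; write $A\le B$ if $B-A$ is positive semi-definite, and let $\|\cdot\|$ be the Euclidean norm. Let $\kappa>0$ and let $h:\mathbb{R}^d\to\mathbb{R}$ be a $(\kappa,V)$-Lipschitz function, i.e. a Borel function such that $$E\big((h(X)-h(X'))^2\big)\le \kappa^2\,E\big(\|X-X'\|^2\big)$$ for every pair of $d$-dimensional random vectors $X,X'$ such that $(X,X')$ is a (possibly degenerate) centered Gaussian vector in $\mathbb{R}^{2d}$ with $\mathrm{cov}(X)\le V$ and $\mathrm{cov}(X')\le V$. Let $(g_k)_{k\ge0}$ be independent standard Gaussian random variables and let $(i_k)_{k\ge0}$ be a sequence of random variables in $\{1,\dots,d\}$, independent of $(g_k)_{k\ge0}$, such that $i_0,\dots,i_{n-1}$ are independent and uniformly distributed over $\{1,\dots,d\}$. Define $X_0=0$ and, for $k\ge0$, $$X_{k+1}=X_k+\big(g_k-e_{i_k}^TX_k\big)\,Ve_{i_k},$$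 where $e_1,\dots,e_d$ is the standard basis of $\mathbb{R}^d$. Then $h$ is integrable with respect to $N(0,V)$ and, with $m=E(h(X))$ for $X\sim N(0,V)$, $$E\left(\left(\frac{1}{n}\sum_{j=0}^{n-1}h(X_j)-m\right)^2\right)\le 18\,\kappa^2\,\frac{d^2}{n}.$$ -/

import Mathlib

open MeasureTheory ProbabilityTheory

noncomputable section

/-- The covariance matrix of a probability measure on `ℝ^d`. -/
def covMatrix {d : ℕ} (μ : Measure (EuclideanSpace ℝ (Fin d))) : Matrix (Fin d) (Fin d) ℝ :=
  Matrix.of fun k l => cov[fun x => x k, fun x => x l; μ]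

/-- `h` is `(κ, γ, W)`-Lipschitz (`κ > 0`, `0 < γ ≤ 1`): it is Borel and
`E (h X - h X')² ≤ κ² (E ‖X - X'‖²) ^ γ` for every centered (possibly degenerate) jointly Gaussian
pair `(X, X')` of `d`-dimensional vectors with `cov X ≤ W` and `cov X' ≤ W` (Loewner order).
The condition depends only on the joint law of `(X, X')`, which is the measure `ν` below.
The integrability clause says that the left-hand expectation is finite. -/
structure IsGaussianLipschitz {d : ℕ} (κ γ : ℝ) (W : Matrix (Fin d) (Fin d) ℝ)
    (h : EuclideanSpace ℝ (Fin d) → ℝ) : Prop where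
  kappa_pos : 0 < κ
  gamma_pos : 0 < γ
  gamma_le_one : γ ≤ 1
  measurable : Measurable h
  bound : ∀ ν : Measure (EuclideanSpace ℝ (Fin d) × EuclideanSpace ℝ (Fin d)),
    IsGaussian ν → ∫ p, p ∂ν = 0 →
    (W - covMatrix (ν.map Prod.fst)).PosSemidef →
    (W - covMatrix (ν.map Prod.snd)).PosSemidef →
    Integrable (fun p => (h p.1 - h p.2) ^ 2) ν ∧
      ∫ p, (h p.1 - h p.2) ^ 2 ∂ν ≤ κ ^ 2 * (∫ p, ‖p.1 - p.2‖ ^ 2 ∂ν) ^ γ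

/-- The chain `X_0 = 0`, `X_{n+1} = X_n + (g_n - e_{i_n}ᵀ X_n) (V e_{i_n})` driven by the index
sequence `i` and the real sequence `g`. -/
def chain {d : ℕ} (V : Matrix (Fin d) (Fin d) ℝ) (i : ℕ → Fin d) (g : ℕ → ℝ) :
    ℕ → EuclideanSpace ℝ (Fin d)
  | 0 => 0
  | n + 1 => chain V i g n + (g n - chain V i g n (i n)) • WithLp.toLp 2 (V.col (i n))

end

open scoped Matrix RealInnerProductSpace

/-! Fix the indices and let `S` be the symmetric square root of `V`. Its columns are unit vectors
because `V` has unit diagonal, so `X_k = S N_k x`, where `x` is the Gaussian noise and the whitened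
state `N_k x` evolves by an orthogonal projection `P_c = 1 - u_c u_cᵀ` followed by fresh noise along
`u_c`. Started instead from an independent standard Gaussian, the whitened chain is stationary, and
its states at times `s` and `s + p` have as cross-covariance the product of the `p` projections in
between (`segProd_mul_transpose_add_noiseMatrix`).

The chain from `0` is coupled with this stationary chain `Y` through the same noise. The Lipschitz
condition bounds the coupling error at time `j` by `κ² tr (S A Aᵀ S)`, with `A` the product of the
first `j` projections. For the covariance of `h(Y_s)` and `h(Y_{s+p})`, the product of projections
is cut in the middle, and a decoupling argument (`integral_mul_sub_sq_le`) bounds it by the mean of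
two such traces, one for each half. Together these give `integral_sq_average_le`.

It remains to average over the indices. A step `Q ↦ (1/d) ∑ P_c Q P_c` lowers `tr Q` by exactly `tr
(S Q S) / d` (`trace_avgConj`), so the mean traces telescope and their sum over all times is at most
`d · tr 1 = d²` (`sum_meanEnergy_le`). No spectral gap of `V` is needed. The coupling contributes `2
d²/n` and the covariances `8 d²/n`, hence the constant `10`, below the required `18`. -/

/-- A real matrix as a continuous linear map between Euclidean spaces. -/
noncomputable def Matrix.euclideanCLM {α ι : Type*} [Fintype α] [Fintype ι] [DecidableEq ι]
    (M : Matrix α ι ℝ) : EuclideanSpace ℝ ι →L[ℝ] EuclideanSpace ℝ α :=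
  (Matrix.toEuclideanLin M).toContinuousLinearMap

lemma Matrix.euclideanCLM_apply {α ι : Type*} [Fintype α] [Fintype ι] [DecidableEq ι]
    (M : Matrix α ι ℝ) (x : EuclideanSpace ℝ ι) :
    M.euclideanCLM x = WithLp.toLp 2 (M *ᵥ x.ofLp) := rfl

/-! ### Linear images of standard Gaussian vectors -/

section GaussianImages

variable {α β ι ι' : Type*} [Fintype α] [Fintype β] [Fintype ι] [Fintype ι']
  [DecidableEq α] [DecidableEq β] [DecidableEq ι] [DecidableEq ι']

lemma Matrix.inner_euclideanCLM_right (M : Matrix α ι ℝ) (t : EuclideanSpace ℝ α)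
    (x : EuclideanSpace ℝ ι) : ⟪t, M.euclideanCLM x⟫ = ⟪Mᵀ.euclideanCLM t, x⟫ := by
  simp only [EuclideanSpace.inner_eq_star_dotProduct, Matrix.euclideanCLM_apply, star_trivial]
  rw [Matrix.mulVec_transpose, dotProduct_comm, Matrix.dotProduct_mulVec, dotProduct_comm]

lemma Matrix.inner_euclideanCLM_transpose (M : Matrix α ι ℝ) (N : Matrix β ι ℝ)
    (s : EuclideanSpace ℝ α) (t : EuclideanSpace ℝ β) :
    ⟪Mᵀ.euclideanCLM s, Nᵀ.euclideanCLM t⟫ = ⟪s, (M * Nᵀ).euclideanCLM t⟫ := by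
  rw [← Matrix.inner_euclideanCLM_right]
  simp [Matrix.euclideanCLM_apply, Matrix.mulVec_mulVec]

lemma charFun_map_euclideanCLM_stdGaussian (M : Matrix α ι ℝ) (t : EuclideanSpace ℝ α) :
    charFun ((stdGaussian (EuclideanSpace ℝ ι)).map M.euclideanCLM) t =
      Complex.exp (-(⟪t, (M * Mᵀ).euclideanCLM t⟫ : ℝ) / 2) := by
  rw [charFun_apply, integral_map (by fun_prop)
    (Measurable.aestronglyMeasurable (by fun_prop))]
  have h : ∀ x : EuclideanSpace ℝ ι, ⟪M.euclideanCLM x, t⟫ = ⟪x, Mᵀ.euclideanCLM t⟫ := by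
    intro x
    rw [real_inner_comm, M.inner_euclideanCLM_right, real_inner_comm]
  simp_rw [h]
  rw [← charFun_apply, charFun_stdGaussian, ← M.inner_euclideanCLM_transpose,
    real_inner_self_eq_norm_sq]
  push_cast
  rfl

/-- The law of a linear image of a standard Gaussian vector only depends on its covariance. -/
lemma map_euclideanCLM_stdGaussian_congr {M : Matrix α ι ℝ} {M' : Matrix α ι' ℝ}
    (h : M * Mᵀ = M' * M'ᵀ) :
    (stdGaussian (EuclideanSpace ℝ ι)).map M.euclideanCLM =
      (stdGaussian (EuclideanSpace ℝ ι')).map M'.euclideanCLM := by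
  have := Measure.isProbabilityMeasure_map (μ := stdGaussian (EuclideanSpace ℝ ι))
    (f := M.euclideanCLM) (by fun_prop)
  have := Measure.isProbabilityMeasure_map (μ := stdGaussian (EuclideanSpace ℝ ι'))
    (f := M'.euclideanCLM) (by fun_prop)
  apply Measure.ext_of_charFun
  ext t
  rw [charFun_map_euclideanCLM_stdGaussian, charFun_map_euclideanCLM_stdGaussian, h]

/-- Any factor of `V` is allowed, not only its square root: the couplings below use rectangular
factors built from several independent noise blocks. -/
lemma multivariateGaussian_zero_eq_map {V : Matrix α α ℝ} (hV : V.PosSemidef)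
    {M : Matrix α ι ℝ} (h : M * Mᵀ = V) :
    multivariateGaussian 0 V = (stdGaussian (EuclideanSpace ℝ ι)).map M.euclideanCLM := by
  have := Measure.isProbabilityMeasure_map (μ := stdGaussian (EuclideanSpace ℝ ι))
    (f := M.euclideanCLM) (by fun_prop)
  apply Measure.ext_of_charFun
  ext t
  rw [charFun_map_euclideanCLM_stdGaussian, charFun_multivariateGaussian hV, h]
  simp [EuclideanSpace.inner_eq_star_dotProduct, Matrix.euclideanCLM_apply, dotProduct_comm,
    neg_div]

lemma map_euclideanCLM_stdGaussian (M : Matrix α ι ℝ) :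
    (stdGaussian (EuclideanSpace ℝ ι)).map M.euclideanCLM = multivariateGaussian 0 (M * Mᵀ) := by
  refine (multivariateGaussian_zero_eq_map ?_ rfl).symm
  simpa using Matrix.posSemidef_self_mul_conjTranspose M

/-- The joint law of two linear images of a standard Gaussian vector only depends on the
covariances and on the cross-covariance. -/
lemma map_prodMk_euclideanCLM_stdGaussian_congr {M : Matrix α ι ℝ} {M' : Matrix α ι' ℝ}
    {N : Matrix β ι ℝ} {N' : Matrix β ι' ℝ} (hM : M * Mᵀ = M' * M'ᵀ) (hN : N * Nᵀ = N' * N'ᵀ)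
    (hMN : M * Nᵀ = M' * N'ᵀ) :
    (stdGaussian (EuclideanSpace ℝ ι)).map (fun x => (M.euclideanCLM x, N.euclideanCLM x)) =
      (stdGaussian (EuclideanSpace ℝ ι')).map
        (fun x => (M'.euclideanCLM x, N'.euclideanCLM x)) := by
  have hNM : N * Mᵀ = N' * M'ᵀ := by
    have := congrArg Matrix.transpose hMN
    simpa [Matrix.transpose_mul] using this
  -- Stacking the rows turns the pair into one linear image, whose covariance has the three given
  -- products and a transpose as blocks.
  have key := map_euclideanCLM_stdGaussian_congr
    (M := Matrix.fromRows M N) (M' := Matrix.fromRows M' N') (by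
      rw [Matrix.transpose_fromRows, Matrix.transpose_fromRows, Matrix.fromRows_mul_fromCols,
        Matrix.fromRows_mul_fromCols, hM, hN, hMN, hNM])
  let pr : EuclideanSpace ℝ (α ⊕ β) → EuclideanSpace ℝ α × EuclideanSpace ℝ β := fun y =>
    (WithLp.toLp 2 fun a => y (Sum.inl a), WithLp.toLp 2 fun b => y (Sum.inr b))
  have hpr : Measurable pr := by fun_prop
  have h := congrArg (Measure.map pr) key
  rw [Measure.map_map hpr (by fun_prop), Measure.map_map hpr (by fun_prop)] at h
  convert h using 2 <;>
  · ext x <;> simp [pr, Matrix.euclideanCLM_apply, Matrix.fromRows_mulVec]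

/-- Jointly Gaussian vectors with zero cross-covariance are independent. -/
lemma indepFun_euclideanCLM_stdGaussian {M : Matrix α ι ℝ} {N : Matrix β ι ℝ} (h : M * Nᵀ = 0) :
    IndepFun M.euclideanCLM N.euclideanCLM (stdGaussian (EuclideanSpace ℝ ι)) := by
  have hG : HasGaussianLaw (fun x => (M.euclideanCLM x, N.euclideanCLM x))
      (stdGaussian (EuclideanSpace ℝ ι)) :=
    IsGaussian.hasGaussianLaw_id.map (M.euclideanCLM.prod N.euclideanCLM)
  refine hG.indepFun_of_covariance_inner fun s t => ?_
  simp_rw [Matrix.inner_euclideanCLM_right]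
  rw [← covarianceBilin_apply_eq_cov IsGaussian.memLp_two_id, covarianceBilin_stdGaussian,
    innerSL_apply_apply, Matrix.inner_euclideanCLM_transpose, h]
  simp [Matrix.euclideanCLM_apply]

lemma covMatrix_map_euclideanCLM_stdGaussian {d : ℕ} (M : Matrix (Fin d) ι ℝ) :
    covMatrix ((stdGaussian (EuclideanSpace ℝ ι)).map M.euclideanCLM) = M * Mᵀ := by
  rw [map_euclideanCLM_stdGaussian]
  ext k l
  have : (M * Mᵀ).PosSemidef := by simpa using Matrix.posSemidef_self_mul_conjTranspose M
  exact covariance_eval_multivariateGaussian this k l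

lemma integral_norm_sq_euclideanCLM_stdGaussian (M : Matrix α ι ℝ) :
    ∫ x, ‖M.euclideanCLM x‖ ^ 2 ∂(stdGaussian (EuclideanSpace ℝ ι)) = (M * Mᵀ).trace := by
  have hp : (M * Mᵀ).PosSemidef := by simpa using Matrix.posSemidef_self_mul_conjTranspose M
  have h1 : ∫ x, ‖M.euclideanCLM x‖ ^ 2 ∂(stdGaussian (EuclideanSpace ℝ ι)) =
      ∫ y, ‖y‖ ^ 2 ∂(multivariateGaussian 0 (M * Mᵀ)) := by
    rw [← map_euclideanCLM_stdGaussian, integral_map (by fun_prop)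
      (Measurable.aestronglyMeasurable (by fun_prop))]
  rw [h1]
  have hm : ∀ k : α, MemLp (fun y : EuclideanSpace ℝ α => y k) 2
      (multivariateGaussian 0 (M * Mᵀ)) := fun k =>
    (EuclideanSpace.proj (𝕜 := ℝ) k).comp_memLp' IsGaussian.memLp_two_id
  have hz : ∀ k : α, ∫ y : EuclideanSpace ℝ α, y k ∂(multivariateGaussian 0 (M * Mᵀ)) = 0 := by
    intro k
    have := (EuclideanSpace.proj (𝕜 := ℝ) k).integral_comp_comm
      (μ := multivariateGaussian 0 (M * Mᵀ)) IsGaussian.integrable_fun_id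
    simpa using this
  simp_rw [EuclideanSpace.real_norm_sq_eq]
  rw [integral_finsetSum _ fun k _ => (hm k).integrable_sq, Matrix.trace]
  refine Finset.sum_congr rfl fun k _ => ?_
  rw [Matrix.diag_apply, ← variance_eval_multivariateGaussian (μ := 0) hp k,
    variance_of_integral_eq_zero (hm k).aestronglyMeasurable.aemeasurable (hz k)]

end GaussianImages

/-! ### Matrix square roots and the Gaussian Lipschitz condition -/

open scoped MatrixOrder in
lemma Matrix.PosSemidef.exists_transpose_eq_self_mul_self_eq {α : Type*} [Fintype α] [DecidableEq α]
    {V : Matrix α α ℝ} (hV : V.PosSemidef) : ∃ S : Matrix α α ℝ, Sᵀ = S ∧ S * S = V := by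
  refine ⟨CFC.sqrt V, ?_, ?_⟩
  · have : (CFC.sqrt V)ᴴ = CFC.sqrt V := (CFC.sqrt_nonneg V).isSelfAdjoint
    rwa [Matrix.conjTranspose_eq_transpose_of_trivial] at this
  · exact CFC.sqrt_mul_sqrt_self V hV.nonneg

namespace IsGaussianLipschitz

variable {d : ℕ} {κ : ℝ} {V : Matrix (Fin d) (Fin d) ℝ} {h : EuclideanSpace ℝ (Fin d) → ℝ}
  {ι : Type*} [Fintype ι] [DecidableEq ι]

/-- The Lipschitz condition for two linear images of a standard Gaussian vector. -/
lemma integrable_and_integral_le (hh : IsGaussianLipschitz κ 1 V h) {M N : Matrix (Fin d) ι ℝ}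
    (hM : (V - M * Mᵀ).PosSemidef) (hN : (V - N * Nᵀ).PosSemidef) :
    Integrable (fun x => (h (M.euclideanCLM x) - h (N.euclideanCLM x)) ^ 2)
        (stdGaussian (EuclideanSpace ℝ ι)) ∧
      ∫ x, (h (M.euclideanCLM x) - h (N.euclideanCLM x)) ^ 2 ∂(stdGaussian (EuclideanSpace ℝ ι))
        ≤ κ ^ 2 * ((M - N) * (M - N)ᵀ).trace := by
  have hmeas := hh.measurable
  set L : EuclideanSpace ℝ ι →L[ℝ] EuclideanSpace ℝ (Fin d) × EuclideanSpace ℝ (Fin d) :=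
    M.euclideanCLM.prod N.euclideanCLM with hL
  have hsub : ∀ x, M.euclideanCLM x - N.euclideanCLM x = (M - N).euclideanCLM x := fun x => by
    simp [Matrix.euclideanCLM_apply, Matrix.sub_mulVec]
  obtain ⟨h1, h2⟩ := hh.bound ((stdGaussian (EuclideanSpace ℝ ι)).map L) inferInstance
    (by
      rw [integral_map (by fun_prop) (by fun_prop),
        ContinuousLinearMap.integral_comp_comm _ IsGaussian.integrable_fun_id]
      simp)
    (by
      rw [Measure.map_map measurable_fst (by fun_prop)]
      exact (covMatrix_map_euclideanCLM_stdGaussian M).symm ▸ hM)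
    (by
      rw [Measure.map_map measurable_snd (by fun_prop)]
      exact (covMatrix_map_euclideanCLM_stdGaussian N).symm ▸ hN)
  have hmh : Measurable fun p : EuclideanSpace ℝ (Fin d) × EuclideanSpace ℝ (Fin d) =>
    (h p.1 - h p.2) ^ 2 := by fun_prop
  rw [integrable_map_measure hmh.aestronglyMeasurable (by fun_prop)] at h1
  rw [integral_map (by fun_prop) hmh.aestronglyMeasurable,
    integral_map (by fun_prop) (Measurable.aestronglyMeasurable (by fun_prop)),
    Real.rpow_one] at h2
  refine ⟨h1, h2.trans_eq ?_⟩
  rw [← integral_norm_sq_euclideanCLM_stdGaussian]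
  simp_rw [← hsub]
  rfl

lemma memLp_two (hh : IsGaussianLipschitz κ 1 V h) {M : Matrix (Fin d) ι ℝ}
    (hM : (V - M * Mᵀ).PosSemidef) :
    MemLp (fun x => h (M.euclideanCLM x)) 2 (stdGaussian (EuclideanSpace ℝ ι)) := by
  have hmeas := hh.measurable
  have hV : V.PosSemidef := by
    have := hM.add (Matrix.posSemidef_self_mul_conjTranspose M)
    simpa using this
  -- Comparison with the zero vector, a degenerate Gaussian: `h(Mx) - h(0)` is square integrable.
  have h1 := (hh.integrable_and_integral_le hM (N := 0) (by simpa using hV)).1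
  have h2 : MemLp (fun x : EuclideanSpace ℝ ι =>
      h (M.euclideanCLM x) - h ((0 : Matrix (Fin d) ι ℝ).euclideanCLM x)) 2
      (stdGaussian (EuclideanSpace ℝ ι)) :=
    (memLp_two_iff_integrable_sq (Measurable.aestronglyMeasurable (by fun_prop))).2 h1
  have h3 := h2.add (memLp_const (h 0))
  refine h3.ae_eq (.of_forall fun x => ?_)
  have : (0 : Matrix (Fin d) ι ℝ).euclideanCLM x = 0 := by simp [Matrix.euclideanCLM_apply]
  simp [this]

lemma integral_comp_euclideanCLM (hh : IsGaussianLipschitz κ 1 V h) (hV : V.PosSemidef)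
    {M : Matrix (Fin d) ι ℝ} (hM : M * Mᵀ = V) :
    ∫ x, h (M.euclideanCLM x) ∂(stdGaussian (EuclideanSpace ℝ ι)) =
      ∫ x, h x ∂(multivariateGaussian 0 V) := by
  rw [multivariateGaussian_zero_eq_map hV hM, integral_map (by fun_prop)
    hh.measurable.aestronglyMeasurable]

lemma integrable_multivariateGaussian (hh : IsGaussianLipschitz κ 1 V h) (hV : V.PosSemidef)
    {M : Matrix (Fin d) ι ℝ} (hM : M * Mᵀ = V) : Integrable h (multivariateGaussian 0 V) := by
  rw [multivariateGaussian_zero_eq_map hV hM, integrable_map_measure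
    hh.measurable.aestronglyMeasurable (by fun_prop)]
  exact (hh.memLp_two (by simpa [hM] using Matrix.PosSemidef.zero)).integrable one_le_two

/-- A covariance bound for two `N(0, V)` vectors whose cross-covariance factors as `C * Dᵀ`. -/
lemma integral_mul_sub_sq_le (hh : IsGaussianLipschitz κ 1 V h) {M N : Matrix (Fin d) ι ℝ}
    (hM : M * Mᵀ = V) (hN : N * Nᵀ = V) {C D : Matrix (Fin d) (Fin d) ℝ}
    (hC : (V - C * Cᵀ).PosSemidef) (hD : (V - D * Dᵀ).PosSemidef) (hMN : M * Nᵀ = C * Dᵀ) :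
    ∫ x, h (M.euclideanCLM x) * h (N.euclideanCLM x) ∂(stdGaussian (EuclideanSpace ℝ ι)) -
        (∫ x, h x ∂(multivariateGaussian 0 V)) ^ 2
      ≤ κ ^ 2 * (((C * Cᵀ).trace + (D * Dᵀ).trace) / 2) := by
  have hmeas := hh.measurable
  have hV : V.PosSemidef := by
    rw [← hM]; simpa using Matrix.posSemidef_self_mul_conjTranspose M
  obtain ⟨R₁, hR₁s, hR₁⟩ := hC.exists_transpose_eq_self_mul_self_eq
  obtain ⟨R₂, hR₂s, hR₂⟩ := hD.exists_transpose_eq_self_mul_self_eq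
  -- With four independent standard Gaussian vectors, `a = C ξ₁ + R₁ ξ₃`, `a' = C ξ₂ + R₁ ξ₃`, `b =
  -- D ξ₁ + R₂ ξ₄` and `b' = D ξ₂ + R₂ ξ₄`. All are `N(0, V)`; `(a, b)` and `(a', b')` have the law
  -- of the given pair, while `a` is independent of `b'` and `a'` of `b`.
  let Ma : Matrix (Fin d) ((Fin d ⊕ Fin d) ⊕ (Fin d ⊕ Fin d)) ℝ :=
    Matrix.fromCols (Matrix.fromCols C 0) (Matrix.fromCols R₁ 0)
  let Ma' : Matrix (Fin d) ((Fin d ⊕ Fin d) ⊕ (Fin d ⊕ Fin d)) ℝ :=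
    Matrix.fromCols (Matrix.fromCols 0 C) (Matrix.fromCols R₁ 0)
  let Mb : Matrix (Fin d) ((Fin d ⊕ Fin d) ⊕ (Fin d ⊕ Fin d)) ℝ :=
    Matrix.fromCols (Matrix.fromCols D 0) (Matrix.fromCols 0 R₂)
  let Mb' : Matrix (Fin d) ((Fin d ⊕ Fin d) ⊕ (Fin d ⊕ Fin d)) ℝ :=
    Matrix.fromCols (Matrix.fromCols 0 D) (Matrix.fromCols 0 R₂)
  have haa : Ma * Maᵀ = V := by
    simp [Ma, Matrix.transpose_fromCols, Matrix.fromCols_mul_fromRows, hR₁s, hR₁]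
  have haa' : Ma' * Ma'ᵀ = V := by
    simp [Ma', Matrix.transpose_fromCols, Matrix.fromCols_mul_fromRows, hR₁s, hR₁]
  have hbb : Mb * Mbᵀ = V := by
    simp [Mb, Matrix.transpose_fromCols, Matrix.fromCols_mul_fromRows, hR₂s, hR₂]
  have hbb' : Mb' * Mb'ᵀ = V := by
    simp [Mb', Matrix.transpose_fromCols, Matrix.fromCols_mul_fromRows, hR₂s, hR₂]
  have hab : M * Nᵀ = Ma * Mbᵀ := by
    simp [Ma, Mb, Matrix.transpose_fromCols, Matrix.fromCols_mul_fromRows, hMN]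
  have hab' : M * Nᵀ = Ma' * Mb'ᵀ := by
    simp [Ma', Mb', Matrix.transpose_fromCols, Matrix.fromCols_mul_fromRows, hMN]
  have hz : Ma * Mb'ᵀ = 0 := by
    simp [Ma, Mb', Matrix.transpose_fromCols, Matrix.fromCols_mul_fromRows]
  have hz' : Ma' * Mbᵀ = 0 := by
    simp [Ma', Mb, Matrix.transpose_fromCols, Matrix.fromCols_mul_fromRows]
  have hda : ((Ma - Ma') * (Ma - Ma')ᵀ).trace = 2 * (C * Cᵀ).trace := by
    have : (Ma - Ma') * (Ma - Ma')ᵀ = C * Cᵀ + C * Cᵀ := by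
      have : Ma - Ma' = Matrix.fromCols (Matrix.fromCols C (-C)) 0 := by
        ext i ((j | j) | (j | j)) <;> simp [Ma, Ma']
      simp [this, Matrix.transpose_fromCols, Matrix.fromCols_mul_fromRows]
    rw [this, Matrix.trace_add, two_mul]
  have hdb : ((Mb - Mb') * (Mb - Mb')ᵀ).trace = 2 * (D * Dᵀ).trace := by
    have : (Mb - Mb') * (Mb - Mb')ᵀ = D * Dᵀ + D * Dᵀ := by
      have : Mb - Mb' = Matrix.fromCols (Matrix.fromCols D (-D)) 0 := by
        ext i ((j | j) | (j | j)) <;> simp [Mb, Mb']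
      simp [this, Matrix.transpose_fromCols, Matrix.fromCols_mul_fromRows]
    rw [this, Matrix.trace_add, two_mul]
  set m := ∫ x, h x ∂(multivariateGaussian 0 V) with hm
  set Γ := stdGaussian (EuclideanSpace ℝ ((Fin d ⊕ Fin d) ⊕ (Fin d ⊕ Fin d)))
  have psd : ∀ {κ : Type} [Fintype κ] {A : Matrix (Fin d) κ ℝ}, A * Aᵀ = V →
      (V - A * Aᵀ).PosSemidef := fun h => by simpa [h] using Matrix.PosSemidef.zero
  have La := hh.memLp_two (psd haa)
  have La' := hh.memLp_two (psd haa')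
  have Lb := hh.memLp_two (psd hbb)
  have Lb' := hh.memLp_two (psd hbb')
  obtain ⟨Ia, Ba⟩ := hh.integrable_and_integral_le (psd haa) (psd haa')
  obtain ⟨Ib, Bb⟩ := hh.integrable_and_integral_le (psd hbb) (psd hbb')
  have law : ∀ {A B : Matrix (Fin d) ((Fin d ⊕ Fin d) ⊕ (Fin d ⊕ Fin d)) ℝ},
      A * Aᵀ = V → B * Bᵀ = V → M * Nᵀ = A * Bᵀ →
      ∫ x, h (A.euclideanCLM x) * h (B.euclideanCLM x) ∂Γ =
        ∫ x, h (M.euclideanCLM x) * h (N.euclideanCLM x) ∂(stdGaussian (EuclideanSpace ℝ ι)) := by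
    intro A B hA hB hAB
    have := map_prodMk_euclideanCLM_stdGaussian_congr (hM.trans hA.symm) (hN.trans hB.symm) hAB
    have hF : Measurable fun p : EuclideanSpace ℝ (Fin d) × EuclideanSpace ℝ (Fin d) =>
      h p.1 * h p.2 := by fun_prop
    have e := congrArg (fun μ => ∫ p, h p.1 * h p.2 ∂μ) this
    simp only at e
    rw [integral_map (by fun_prop) hF.aestronglyMeasurable,
      integral_map (by fun_prop) hF.aestronglyMeasurable] at e
    exact e.symm
  have indep : ∀ {A B : Matrix (Fin d) ((Fin d ⊕ Fin d) ⊕ (Fin d ⊕ Fin d)) ℝ},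
      A * Aᵀ = V → B * Bᵀ = V → A * Bᵀ = 0 →
      ∫ x, h (A.euclideanCLM x) * h (B.euclideanCLM x) ∂Γ = m ^ 2 := by
    intro A B hA hB hAB
    have := ((indepFun_euclideanCLM_stdGaussian hAB).comp hmeas
      hmeas).integral_fun_mul_eq_mul_integral (Measurable.aestronglyMeasurable (by fun_prop))
      (Measurable.aestronglyMeasurable (by fun_prop))
    simp only [Function.comp_apply] at this
    rw [this, hh.integral_comp_euclideanCLM hV hA, hh.integral_comp_euclideanCLM hV hB, sq]
  have e1 := law haa hbb hab
  have e2 := law haa' hbb' hab'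
  have e3 := indep haa hbb' hz
  have e4 := indep haa' hbb hz'
  have i1 := La.integrable_mul Lb
  have i2 := La'.integrable_mul Lb'
  have i3 := La.integrable_mul Lb'
  have i4 := La'.integrable_mul Lb
  simp only [Pi.mul_def] at i1 i2 i3 i4
  -- The two matched products give the given expectation, the two mixed ones give `m²`. The
  -- covariance is thus half the mean of a product of differences, to which `2uv ≤ u² + v²` and the
  -- Lipschitz bound apply.
  have expand : ∫ x, (h (Ma.euclideanCLM x) - h (Ma'.euclideanCLM x)) *
      (h (Mb.euclideanCLM x) - h (Mb'.euclideanCLM x)) ∂Γ =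
      2 * (∫ x, h (M.euclideanCLM x) * h (N.euclideanCLM x) ∂(stdGaussian (EuclideanSpace ℝ ι)) -
        m ^ 2) := by
    calc _ = ∫ x, ((h (Ma.euclideanCLM x) * h (Mb.euclideanCLM x) +
          h (Ma'.euclideanCLM x) * h (Mb'.euclideanCLM x)) -
          (h (Ma.euclideanCLM x) * h (Mb'.euclideanCLM x) +
          h (Ma'.euclideanCLM x) * h (Mb.euclideanCLM x))) ∂Γ := by
            congr 1; ext x; ring
      _ = _ := by
        rw [integral_sub (by exact i1.add i2) (by exact i3.add i4), integral_add i1 i2,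
          integral_add i3 i4, e1, e2, e3, e4]
        ring
  have le : ∫ x, (h (Ma.euclideanCLM x) - h (Ma'.euclideanCLM x)) *
      (h (Mb.euclideanCLM x) - h (Mb'.euclideanCLM x)) ∂Γ ≤
      ∫ x, ((h (Ma.euclideanCLM x) - h (Ma'.euclideanCLM x)) ^ 2 / 2 +
      (h (Mb.euclideanCLM x) - h (Mb'.euclideanCLM x)) ^ 2 / 2) ∂Γ := by
    refine integral_mono ((La.sub La').integrable_mul (Lb.sub Lb'))
      ((Ia.div_const 2).add (Ib.div_const 2)) fun x => ?_
    have := sq_nonneg ((h (Ma.euclideanCLM x) - h (Ma'.euclideanCLM x)) -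
      (h (Mb.euclideanCLM x) - h (Mb'.euclideanCLM x)))
    simp only
    nlinarith
  rw [expand, integral_add (Ia.div_const 2) (Ib.div_const 2), integral_div, integral_div] at le
  rw [hda] at Ba
  rw [hdb] at Bb
  linarith

end IsGaussianLipschitz

/-! ### Products of projections and the whitened chain -/

/-- The matrix `1 - u uᵀ`, where `u` is the column of `S` of index `c`. -/
def colProj {d : ℕ} (S : Matrix (Fin d) (Fin d) ℝ) (c : Fin d) : Matrix (Fin d) (Fin d) ℝ :=
  1 - Matrix.vecMulVec (S.col c) (S.col c)

/-- The product of `m` successive projections, from the time `s` on. -/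
def segProd {d : ℕ} (S : Matrix (Fin d) (Fin d) ℝ) (i : ℕ → Fin d) (s : ℕ) :
    ℕ → Matrix (Fin d) (Fin d) ℝ
  | 0 => 1
  | m + 1 => colProj S (i (s + m)) * segProd S i s m

/-- The matrix that gives the state of the whitened chain at time `k` in terms of the noise. -/
def noiseMatrix {d : ℕ} {ι : Type*} (S : Matrix (Fin d) (Fin d) ℝ) (e : ℕ → ι → ℝ)
    (i : ℕ → Fin d) : ℕ → Matrix (Fin d) ι ℝ
  | 0 => 0
  | k + 1 => colProj S (i k) * noiseMatrix S e i k + Matrix.vecMulVec (S.col (i k)) (e k)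

section Projections

variable {d : ℕ} {S : Matrix (Fin d) (Fin d) ℝ}

@[simp]
lemma colProj_transpose (c : Fin d) : (colProj S c)ᵀ = colProj S c := by
  simp [colProj, Matrix.transpose_sub, Matrix.transpose_vecMulVec]

lemma colProj_mul_self (hS : ∀ c, S.col c ⬝ᵥ S.col c = 1) (c : Fin d) :
    colProj S c * colProj S c = colProj S c := by
  simp [colProj, sub_mul, mul_sub, Matrix.vecMulVec_mul_vecMulVec, hS]

lemma posSemidef_one_sub_colProj (c : Fin d) : (1 - colProj S c).PosSemidef := by
  have := Matrix.posSemidef_vecMulVec_self_star (S.col c)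
  simpa [colProj] using this

variable (i : ℕ → Fin d)

lemma segProd_add (s q r : ℕ) :
    segProd S i s (q + r) = segProd S i (s + q) r * segProd S i s q := by
  induction r with
  | zero => simp [segProd]
  | succ r ih => rw [← add_assoc, segProd, segProd, ih, Matrix.mul_assoc, add_assoc]

lemma segProd_succ_eq_mul_colProj (s m : ℕ) :
    segProd S i s (m + 1) = segProd S i (s + 1) m * colProj S (i s) := by
  rw [add_comm, segProd_add]
  simp [segProd]

/-- Peeling off the last projection: `1 - P A Aᵀ P = P (1 - A Aᵀ) P + (1 - P)`. -/
lemma posSemidef_one_sub_segProd_mul_transpose (hS : ∀ c, S.col c ⬝ᵥ S.col c = 1) (s m : ℕ) :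
    (1 - segProd S i s m * (segProd S i s m)ᵀ).PosSemidef := by
  induction m with
  | zero => simpa [segProd] using Matrix.PosSemidef.zero
  | succ m ih =>
    have h1 := ih.mul_mul_conjTranspose_same (colProj S (i (s + m)))
    have h2 := h1.add (posSemidef_one_sub_colProj (S := S) (i (s + m)))
    convert h2 using 1
    rw [Matrix.conjTranspose_eq_transpose_of_trivial, colProj_transpose, segProd,
      Matrix.transpose_mul, colProj_transpose, mul_sub, sub_mul, mul_one, colProj_mul_self hS]
    simp only [Matrix.mul_assoc]
    abel

/-- Same identity, peeling off the first projection instead; hence the induction over all starting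
times. -/
lemma posSemidef_one_sub_transpose_mul_segProd (hS : ∀ c, S.col c ⬝ᵥ S.col c = 1) (s m : ℕ) :
    (1 - (segProd S i s m)ᵀ * segProd S i s m).PosSemidef := by
  induction m generalizing s with
  | zero => simpa [segProd] using Matrix.PosSemidef.zero
  | succ m ih =>
    have h1 := (ih (s + 1)).mul_mul_conjTranspose_same (colProj S (i s))
    have h2 := h1.add (posSemidef_one_sub_colProj (S := S) (i s))
    convert h2 using 1
    rw [Matrix.conjTranspose_eq_transpose_of_trivial, colProj_transpose,
      segProd_succ_eq_mul_colProj, Matrix.transpose_mul, colProj_transpose, mul_sub, sub_mul,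
      mul_one, colProj_mul_self hS]
    simp only [Matrix.mul_assoc]
    abel

section Noise

variable {ι : Type*} [Fintype ι] {e : ℕ → ι → ℝ} {n : ℕ}

/-- The state at time `j` only involves the noise directions before `j`, which are orthogonal to `e
k`. -/
lemma noiseMatrix_mulVec_eq_zero (he : ∀ j k, j < k → k < n → e j ⬝ᵥ e k = 0) {j k : ℕ}
    (hjk : j ≤ k) (hk : k < n) : noiseMatrix S e i j *ᵥ e k = 0 := by
  induction j with
  | zero => simp [noiseMatrix]
  | succ j ih =>
    rw [noiseMatrix, Matrix.add_mulVec, ← Matrix.mulVec_mulVec, ih (by omega),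
      Matrix.vecMulVec_mulVec, he j k hjk hk]
    simp

/-- Stationarity: from an independent standard Gaussian start, the whitened state keeps covariance
`1`, since `P · 1 · P + u uᵀ = 1`. Each later step multiplies the cross-covariance by its
projection, the new noise being uncorrelated with the past. -/
lemma segProd_mul_transpose_add_noiseMatrix (hS : ∀ c, S.col c ⬝ᵥ S.col c = 1)
    (he : ∀ j k, j < k → k < n → e j ⬝ᵥ e k = 0) (he1 : ∀ k, e k ⬝ᵥ e k = 1)
    (j p : ℕ) (hjp : j + p ≤ n) :
    segProd S i 0 (j + p) * (segProd S i 0 j)ᵀ +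
      noiseMatrix S e i (j + p) * (noiseMatrix S e i j)ᵀ = segProd S i j p := by
  induction p with
  | zero =>
    rw [add_zero] at hjp ⊢
    induction j with
    | zero => simp [segProd, noiseMatrix]
    | succ j ih =>
      have h0 := noiseMatrix_mulVec_eq_zero (S := S) i he (le_refl j) (by omega)
      have ih := ih (by omega)
      have ih : segProd S i 0 j * (segProd S i 0 j)ᵀ +
        noiseMatrix S e i j * (noiseMatrix S e i j)ᵀ = 1 := ih
      have h1 : noiseMatrix S e i j * Matrix.vecMulVec (e j) (S.col (i j)) = 0 := by
        rw [Matrix.mul_vecMulVec, h0]; simp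
      have h2 : Matrix.vecMulVec (S.col (i j)) (e j) * (noiseMatrix S e i j)ᵀ = 0 := by
        rw [Matrix.vecMulVec_mul, Matrix.vecMul_transpose, h0]; simp
      have h3 : Matrix.vecMulVec (S.col (i j)) (e j) * Matrix.vecMulVec (e j) (S.col (i j)) =
          Matrix.vecMulVec (S.col (i j)) (S.col (i j)) := by
        simp [Matrix.vecMulVec_mul_vecMulVec, he1]
      calc segProd S i 0 (j + 1) * (segProd S i 0 (j + 1))ᵀ +
            noiseMatrix S e i (j + 1) * (noiseMatrix S e i (j + 1))ᵀ
          = colProj S (i j) * (segProd S i 0 j * (segProd S i 0 j)ᵀ +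
              noiseMatrix S e i j * (noiseMatrix S e i j)ᵀ) * colProj S (i j) +
            colProj S (i j) * (noiseMatrix S e i j * Matrix.vecMulVec (e j) (S.col (i j))) +
            Matrix.vecMulVec (S.col (i j)) (e j) * (noiseMatrix S e i j)ᵀ * colProj S (i j) +
            Matrix.vecMulVec (S.col (i j)) (e j) * Matrix.vecMulVec (e j) (S.col (i j)) := by
            rw [segProd, noiseMatrix]
            simp only [zero_add, Matrix.transpose_mul, Matrix.transpose_add, colProj_transpose,
              Matrix.transpose_vecMulVec, Matrix.mul_add, Matrix.add_mul, Matrix.mul_assoc]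
            abel
        _ = 1 := by
            rw [ih, h1, h2, h3, mul_one, colProj_mul_self hS]
            simp [colProj]
  | succ p ih =>
    have h0 := noiseMatrix_mulVec_eq_zero (S := S) i he (show j ≤ j + p by omega) (by omega)
    rw [← add_assoc, segProd, noiseMatrix, Matrix.add_mul, zero_add, Matrix.mul_assoc,
      Matrix.mul_assoc, Matrix.vecMulVec_mul, Matrix.vecMul_transpose, h0, Matrix.vecMulVec_zero,
      add_zero,
      ← Matrix.mul_add, ih (by omega), segProd]

/-- The chain is a linear image of the noise. -/
lemma chain_eq_euclideanCLM [DecidableEq ι] {V : Matrix (Fin d) (Fin d) ℝ} (hSt : Sᵀ = S)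
    (hSV : S * S = V) (g : ℕ → ℝ) (x : EuclideanSpace ℝ ι) (hg : ∀ k, e k ⬝ᵥ x.ofLp = g k) (k : ℕ) :
    chain V i g k = (S * noiseMatrix S e i k).euclideanCLM x := by
  induction k with
  | zero => simp [chain, noiseMatrix, Matrix.euclideanCLM_apply]
  | succ k ih =>
    have hcol : V.col (i k) = S *ᵥ S.col (i k) := by
      rw [← hSV]
      ext a
      simp [Matrix.mulVec, dotProduct, Matrix.mul_apply]
    have hdot : S.col (i k) ⬝ᵥ (noiseMatrix S e i k *ᵥ x.ofLp) =
        (S *ᵥ (noiseMatrix S e i k *ᵥ x.ofLp)) (i k) := by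
      have : S.col (i k) = S (i k) := congrFun hSt (i k)
      rw [this]
      rfl
    rw [chain, ih, hcol, noiseMatrix]
    simp only [Matrix.euclideanCLM_apply]
    rw [← WithLp.toLp_smul, ← WithLp.toLp_add]
    congr 1
    simp only [← Matrix.mulVec_mulVec, Matrix.add_mulVec, Matrix.vecMulVec_mulVec, hg,
      Matrix.mulVec_add, colProj, Matrix.sub_mulVec, Matrix.one_mulVec, hdot, Matrix.mulVec_sub]
    ext a
    simp [Matrix.mulVec_smul]
    ring

end Noise

end Projections

/-! ### Averaging over the indices -/

/-- The operator `Q ↦ (1 / d) * ∑ c, P_c Q P_c`. -/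
noncomputable def avgConj {d : ℕ} (S : Matrix (Fin d) (Fin d) ℝ) (Q : Matrix (Fin d) (Fin d) ℝ) :
    Matrix (Fin d) (Fin d) ℝ :=
  (d : ℝ)⁻¹ • ∑ c, colProj S c * Q * colProj S c

/-- The mean of `tr (V Q)`, where `Q` is the square of a random product of `m` projections. -/
noncomputable def meanEnergy {d : ℕ} (S : Matrix (Fin d) (Fin d) ℝ) (m : ℕ) : ℝ :=
  (S * ((avgConj S)^[m] 1) * S).trace

section Averaging

variable {d : ℕ} {S : Matrix (Fin d) (Fin d) ℝ}

lemma avgConj_sum {ι : Type*} (s : Finset ι) (Q : ι → Matrix (Fin d) (Fin d) ℝ) :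
    avgConj S (∑ l ∈ s, Q l) = ∑ l ∈ s, avgConj S (Q l) := by
  simp only [avgConj, Finset.mul_sum, Finset.sum_mul]
  rw [Finset.sum_comm, Finset.smul_sum]

lemma avgConj_smul (a : ℝ) (Q : Matrix (Fin d) (Fin d) ℝ) :
    avgConj S (a • Q) = a • avgConj S Q := by
  simp only [avgConj, Matrix.mul_smul, Matrix.smul_mul, ← Finset.smul_sum]
  rw [smul_comm]

lemma posSemidef_avgConj {Q : Matrix (Fin d) (Fin d) ℝ} (hQ : Q.PosSemidef) :
    (avgConj S Q).PosSemidef := by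
  refine Matrix.PosSemidef.smul (Matrix.posSemidef_sum _ fun c _ => ?_) (by positivity)
  simpa using hQ.mul_mul_conjTranspose_same (colProj S c)

lemma posSemidef_iterate_avgConj (m : ℕ) : ((avgConj S)^[m] 1).PosSemidef := by
  induction m with
  | zero => exact Matrix.PosSemidef.one
  | succ m ih => rw [Function.iterate_succ_apply']; exact posSemidef_avgConj ih

lemma sum_vecMulVec_col (hSt : Sᵀ = S) :
    ∑ c, Matrix.vecMulVec (S.col c) (S.col c) = S * S := by
  conv_rhs => rw [← hSt]
  ext a b
  have : ∀ x y, S x y = S y x := fun x y => congrFun (congrFun hSt y) x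
  simp [Matrix.sum_apply, Matrix.vecMulVec_apply, Matrix.mul_apply]
  exact Finset.sum_congr rfl fun c _ => by rw [this a c]

/-- By idempotence `tr (P_c Q P_c) = tr Q - tr (u_c u_cᵀ Q)`, and the matrices `u_c u_cᵀ` add up to
`S * S`. -/
lemma trace_avgConj (hd : d ≠ 0) (hSt : Sᵀ = S) (hS : ∀ c, S.col c ⬝ᵥ S.col c = 1)
    (Q : Matrix (Fin d) (Fin d) ℝ) :
    (avgConj S Q).trace = Q.trace - (d : ℝ)⁻¹ * (S * Q * S).trace := by
  have h1 : ∀ c, (colProj S c * Q * colProj S c).trace =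
      Q.trace - (Matrix.vecMulVec (S.col c) (S.col c) * Q).trace := by
    intro c
    rw [Matrix.trace_mul_comm, ← Matrix.mul_assoc, colProj_mul_self hS, colProj, sub_mul,
      Matrix.trace_sub, one_mul]
  have hd' : (d : ℝ) ≠ 0 := by exact_mod_cast hd
  rw [avgConj, Matrix.trace_smul, Matrix.trace_sum, Finset.sum_congr rfl fun c _ => h1 c,
    Finset.sum_sub_distrib, ← Matrix.trace_sum Finset.univ fun c =>
      Matrix.vecMulVec (S.col c) (S.col c) * Q, ← Finset.sum_mul, sum_vecMulVec_col hSt,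
    Matrix.trace_mul_comm (S * Q) S, Matrix.mul_assoc]
  simp [mul_sub, hd']

lemma meanEnergy_nonneg (hSt : Sᵀ = S) (m : ℕ) : 0 ≤ meanEnergy S m := by
  have := (posSemidef_iterate_avgConj (S := S) m).mul_mul_conjTranspose_same S
  rw [Matrix.conjTranspose_eq_transpose_of_trivial, hSt] at this
  exact this.trace_nonneg

/-- Each term is `d` times the loss of trace in one averaging step, so the sum telescopes; the
remaining trace is nonnegative. -/
lemma sum_meanEnergy_le (hd : d ≠ 0) (hSt : Sᵀ = S) (hS : ∀ c, S.col c ⬝ᵥ S.col c = 1) (N : ℕ) :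
    ∑ m ∈ Finset.range N, meanEnergy S m ≤ (d : ℝ) ^ 2 := by
  have hd' : (d : ℝ) ≠ 0 := by exact_mod_cast hd
  have h : ∀ m, meanEnergy S m =
      d * ((avgConj S)^[m] 1).trace - d * ((avgConj S)^[m + 1] 1).trace := by
    intro m
    rw [Function.iterate_succ_apply', trace_avgConj hd hSt hS, meanEnergy]
    field_simp
    ring
  rw [Finset.sum_congr rfl fun m _ => h m,
    Finset.sum_range_sub' (fun m => d * ((avgConj S)^[m] 1).trace)]
  have := mul_nonneg (Nat.cast_nonneg (α := ℝ) d)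
    (posSemidef_iterate_avgConj (S := S) N).trace_nonneg
  simp only [Function.iterate_zero, id_eq, Matrix.trace_one, Fintype.card_fin]
  nlinarith

/-- Among `p < 2N`, each `m < N` occurs twice as `p / 2`; as `p - p / 2` it also occurs twice,
except that `0` occurs once, and `N` occurs once. Each half therefore costs a factor of two. -/
lemma sum_meanEnergy_half_le (hd : d ≠ 0) (hSt : Sᵀ = S) (hS : ∀ c, S.col c ⬝ᵥ S.col c = 1)
    (N : ℕ) :
    ∑ p ∈ Finset.range N, (meanEnergy S (p / 2) + meanEnergy S (p - p / 2)) / 2 ≤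
      2 * (d : ℝ) ^ 2 := by
  have hnn := meanEnergy_nonneg (S := S) hSt
  have h1 : ∀ N, ∑ p ∈ Finset.range (2 * N), meanEnergy S (p / 2) =
      2 * ∑ m ∈ Finset.range N, meanEnergy S m := by
    intro N
    induction N with
    | zero => simp
    | succ N ih =>
      rw [show 2 * (N + 1) = 2 * N + 1 + 1 by ring, Finset.sum_range_succ, Finset.sum_range_succ,
        ih, Finset.sum_range_succ, show 2 * N / 2 = N by omega, show (2 * N + 1) / 2 = N by omega]
      ring
  have h2 : ∀ N, ∑ p ∈ Finset.range (2 * N), meanEnergy S (p - p / 2) ≤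
      2 * ∑ m ∈ Finset.range N, meanEnergy S m + meanEnergy S N - meanEnergy S 0 := by
    intro N
    induction N with
    | zero => simp
    | succ N ih =>
      rw [show 2 * (N + 1) = 2 * N + 1 + 1 by ring, Finset.sum_range_succ, Finset.sum_range_succ,
        Finset.sum_range_succ, show 2 * N - 2 * N / 2 = N by omega,
        show 2 * N + 1 - (2 * N + 1) / 2 = N + 1 by omega]
      linarith
  have hN : ∑ p ∈ Finset.range N, (meanEnergy S (p / 2) + meanEnergy S (p - p / 2)) / 2 ≤
      ∑ p ∈ Finset.range (2 * N), (meanEnergy S (p / 2) + meanEnergy S (p - p / 2)) / 2 :=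
    Finset.sum_le_sum_of_subset_of_nonneg (Finset.range_mono (by omega)) fun p _ _ => by
      have := hnn (p / 2); have := hnn (p - p / 2); positivity
  have h3 := sum_meanEnergy_le hd hSt hS N
  have h4 := sum_meanEnergy_le hd hSt hS (N + 1)
  rw [Finset.sum_range_succ] at h4
  rw [← Finset.sum_div, ← Finset.sum_div, Finset.sum_add_distrib, Finset.sum_add_distrib] at hN
  rw [← Finset.sum_div, Finset.sum_add_distrib]
  have := h1 N
  have := h2 N
  have := hnn 0
  linarith

/-- Each distance to `j` is attained at most once on either side of `j`. -/
lemma sum_range_dist_le {F : ℕ → ℝ} (hF : ∀ p, 0 ≤ F p) {C : ℝ} {n : ℕ}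
    (hC : ∑ p ∈ Finset.range n, F p ≤ C) {j : ℕ} (hj : j < n) :
    ∑ k ∈ Finset.range n, F (max j k - min j k) ≤ 2 * C := by
  have hsplit : n = j + (n - j) := by omega
  have h1 : ∑ k ∈ Finset.range j, F (max j k - min j k) ≤ ∑ p ∈ Finset.range n, F p := by
    have e : ∑ k ∈ Finset.range j, F (max j k - min j k) =
        ∑ k ∈ Finset.range j, F (j - 1 - k + 1) := by
      refine Finset.sum_congr rfl fun k hk => ?_
      have := Finset.mem_range.1 hk
      congr 1; omega
    rw [e, Finset.sum_range_reflect (fun k => F (k + 1)) j]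
    calc _ ≤ ∑ p ∈ Finset.range (j + 1), F p := by
          rw [Finset.sum_range_succ']; linarith [hF 0]
      _ ≤ _ := Finset.sum_le_sum_of_subset_of_nonneg (Finset.range_mono (by omega))
          fun p _ _ => hF p
  have h2 : ∑ k ∈ Finset.range (n - j), F (max j (j + k) - min j (j + k)) ≤
      ∑ p ∈ Finset.range n, F p := by
    have e : ∑ k ∈ Finset.range (n - j), F (max j (j + k) - min j (j + k)) =
        ∑ k ∈ Finset.range (n - j), F k := by
      refine Finset.sum_congr rfl fun k hk => ?_
      congr 1; omega
    rw [e]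
    exact Finset.sum_le_sum_of_subset_of_nonneg (Finset.range_mono (by omega)) fun p _ _ => hF p
  conv_lhs => rw [hsplit]
  rw [Finset.sum_range_add]
  linarith

/-- Resampling one coordinate of a uniformly distributed word. -/
lemma sum_sum_update {α ι E : Type*} [Fintype α] [Fintype ι] [DecidableEq ι] [AddCommGroup E]
    [Module ℝ E] (t : ι) (G : (ι → α) → E) :
    ∑ l, ∑ c, G (Function.update l t c) = (Fintype.card α : ℝ) • ∑ l, G l := by
  classical
  let e := Equiv.funSplitAt t α
  have hu : ∀ l c, G (Function.update l t c) = G (e.symm (c, (e l).2)) := by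
    intro l c
    congr 1
  simp_rw [hu]
  rw [← e.symm.sum_comp fun l => ∑ c, G (e.symm (c, (e l).2)), ← e.symm.sum_comp G]
  simp only [Equiv.apply_symm_apply]
  rw [Fintype.sum_prod_type, Fintype.sum_prod_type]
  simp only [Finset.sum_const, Finset.card_univ]
  rw [Finset.sum_comm, Nat.cast_smul_eq_nsmul]

lemma segProd_congr {i i' : ℕ → Fin d} {s m : ℕ} (h : ∀ k, s ≤ k → k < s + m → i k = i' k) :
    segProd S i s m = segProd S i' s m := by
  induction m with
  | zero => rfl
  | succ m ih =>
    rw [segProd, segProd, ih fun k h1 h2 => h k h1 (by omega), h _ (by omega) (by omega)]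

variable {n : ℕ}

/-- Since `Q` ignores the letter at `t`, that letter may be resampled, which replaces the
conjugation by its average. -/
lemma sum_colProj_mul_mul (hd : d ≠ 0) (t : Fin n)
    (Q : (Fin n → Fin d) → Matrix (Fin d) (Fin d) ℝ)
    (hQ : ∀ l c, Q (Function.update l t c) = Q l) :
    ∑ l, colProj S (l t) * Q l * colProj S (l t) = avgConj S (∑ l, Q l) := by
  have hd' : (d : ℝ) ≠ 0 := by exact_mod_cast hd
  have := sum_sum_update t fun l : Fin n → Fin d => colProj S (l t) * Q l * colProj S (l t)
  simp only [Function.update_self, hQ, Fintype.card_fin] at this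
  rw [avgConj_sum]
  simp only [avgConj]
  rw [← Finset.smul_sum, this, smul_smul, inv_mul_cancel₀ hd', one_smul]

variable [NeZero n]

lemma segProd_update (l : Fin n → Fin d) (t : Fin n) (c : Fin d) {s m : ℕ} (hm : s + m ≤ n)
    (ht : ∀ k, s ≤ k → k < s + m → k ≠ t) :
    segProd S (fun k => Function.update l t c (Fin.ofNat n k)) s m =
      segProd S (fun k => l (Fin.ofNat n k)) s m := by
  refine segProd_congr fun k h1 h2 => Function.update_of_ne ?_ _ _
  intro h
  refine ht k h1 h2 ?_
  rw [← h, Fin.val_ofNat, Nat.mod_eq_of_lt (by omega)]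

lemma sum_segProd_mul_transpose (hd : d ≠ 0) {s m : ℕ} (hm : s + m ≤ n) :
    ∑ l : Fin n → Fin d, segProd S (fun k => l (Fin.ofNat n k)) s m *
      (segProd S (fun k => l (Fin.ofNat n k)) s m)ᵀ =
      (d : ℝ) ^ n • (avgConj S)^[m] 1 := by
  induction m with
  | zero => simp [segProd, ← Nat.cast_smul_eq_nsmul ℝ]
  | succ m ih =>
    have h := sum_colProj_mul_mul (S := S) hd (Fin.ofNat n (s + m))
      (fun l => segProd S (fun k => l (Fin.ofNat n k)) s m *
        (segProd S (fun k => l (Fin.ofNat n k)) s m)ᵀ) (fun l c => by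
          rw [segProd_update l _ c (by omega) fun k h1 h2 => by
            rw [Fin.val_ofNat, Nat.mod_eq_of_lt (by omega)]; omega])
    rw [ih (by omega), avgConj_smul, ← Function.iterate_succ_apply' (avgConj S)] at h
    rw [← h]
    refine Finset.sum_congr rfl fun l _ => ?_
    simp [segProd, Matrix.transpose_mul, Matrix.mul_assoc]

/-- Here the first letter is peeled off, where `sum_segProd_mul_transpose` peels off the last. The
letters being i.i.d. under the uniform law, both orders give the same iterate, so both halves of a
cut product have the same kind of mean. -/
lemma sum_transpose_mul_segProd (hd : d ≠ 0) {s m : ℕ} (hm : s + m ≤ n) :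
    ∑ l : Fin n → Fin d, (segProd S (fun k => l (Fin.ofNat n k)) s m)ᵀ *
      segProd S (fun k => l (Fin.ofNat n k)) s m =
      (d : ℝ) ^ n • (avgConj S)^[m] 1 := by
  induction m generalizing s with
  | zero => simp [segProd, ← Nat.cast_smul_eq_nsmul ℝ]
  | succ m ih =>
    have h := sum_colProj_mul_mul (S := S) hd (Fin.ofNat n s)
      (fun l => (segProd S (fun k => l (Fin.ofNat n k)) (s + 1) m)ᵀ *
        segProd S (fun k => l (Fin.ofNat n k)) (s + 1) m) (fun l c => by
          rw [segProd_update l _ c (by omega) fun k h1 h2 => by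
            rw [Fin.val_ofNat, Nat.mod_eq_of_lt (by omega)]; omega])
    rw [ih (by omega), avgConj_smul, ← Function.iterate_succ_apply' (avgConj S)] at h
    rw [← h]
    refine Finset.sum_congr rfl fun l _ => ?_
    simp [segProd_succ_eq_mul_colProj, Matrix.transpose_mul, Matrix.mul_assoc]

end Averaging

/-! ### Mean square bounds: covariances and coupling -/

/-- The bound on the covariance at the times `s` and `s + p` of the stationary chain, up to `κ²`. -/
noncomputable def covBound {d : ℕ} (S : Matrix (Fin d) (Fin d) ℝ) (i : ℕ → Fin d) (s p : ℕ) : ℝ :=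
  ((S * ((segProd S i s (p / 2))ᵀ * segProd S i s (p / 2)) * S).trace +
    (S * (segProd S i (s + p / 2) (p - p / 2) *
      (segProd S i (s + p / 2) (p - p / 2))ᵀ) * S).trace) / 2

section SquaredMeans

variable {Ω : Type*} [MeasurableSpace Ω] {μ : Measure Ω} [IsProbabilityMeasure μ]

lemma integral_sq_sum_div_sub_le {n : ℕ} (hn : 0 < n) {Z : ℕ → Ω → ℝ} {m : ℝ} {B : ℕ → ℕ → ℝ}
    (hZ : ∀ j < n, MemLp (Z j) 2 μ) (hm : ∀ j < n, ∫ ω, Z j ω ∂μ = m)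
    (hB : ∀ j < n, ∀ k < n, ∫ ω, Z j ω * Z k ω ∂μ - m ^ 2 ≤ B j k) :
    ∫ ω, ((∑ j ∈ Finset.range n, Z j ω) / n - m) ^ 2 ∂μ ≤
      (∑ j ∈ Finset.range n, ∑ k ∈ Finset.range n, B j k) / n ^ 2 := by
  have hn' : (n : ℝ) ≠ 0 := by exact_mod_cast hn.ne'
  have hpt : ∀ ω, ((∑ j ∈ Finset.range n, Z j ω) / n - m) ^ 2 =
      (∑ j ∈ Finset.range n, ∑ k ∈ Finset.range n, (Z j ω - m) * (Z k ω - m)) / n ^ 2 := by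
    intro ω
    rw [← Finset.sum_mul_sum, Finset.sum_sub_distrib]
    simp only [Finset.sum_const, Finset.card_range, nsmul_eq_mul]
    field_simp
  have hL : ∀ j < n, MemLp (fun ω => Z j ω - m) 2 μ := fun j hj => (hZ j hj).sub (memLp_const m)
  have hi : ∀ j < n, ∀ k < n, Integrable (fun ω => (Z j ω - m) * (Z k ω - m)) μ :=
    fun j hj k hk => (hL j hj).integrable_mul (hL k hk)
  have hv : ∀ j < n, ∀ k < n, ∫ ω, (Z j ω - m) * (Z k ω - m) ∂μ =
      ∫ ω, Z j ω * Z k ω ∂μ - m ^ 2 := by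
    intro j hj k hk
    have i1 : Integrable (fun ω => Z j ω * Z k ω) μ := (hZ j hj).integrable_mul (hZ k hk)
    have i2 := ((hZ j hj).integrable one_le_two).const_mul m
    have i3 := ((hZ k hk).integrable one_le_two).const_mul m
    calc ∫ ω, (Z j ω - m) * (Z k ω - m) ∂μ
        = ∫ ω, ((Z j ω * Z k ω + m ^ 2) - (m * Z j ω + m * Z k ω)) ∂μ := by
          congr 1; ext ω; ring
      _ = _ := by
          rw [integral_sub (by exact i1.add (integrable_const _)) (by exact i2.add i3),
            integral_add i1 (integrable_const _), integral_add i2 i3, integral_const_mul,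
            integral_const_mul, hm j hj, hm k hk]
          simp
          ring
  simp_rw [hpt]
  rw [integral_div, integral_finsetSum _ fun j hj => integrable_finsetSum _ fun k hk =>
    hi j (Finset.mem_range.1 hj) k (Finset.mem_range.1 hk)]
  refine div_le_div_of_nonneg_right (Finset.sum_le_sum fun j hj => ?_) (by positivity)
  have hj := Finset.mem_range.1 hj
  rw [integral_finsetSum _ fun k hk => hi j hj k (Finset.mem_range.1 hk)]
  refine Finset.sum_le_sum fun k hk => ?_
  have hk := Finset.mem_range.1 hk
  rw [hv j hj k hk]
  exact hB j hj k hk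

/-- `(a + b)² ≤ 2a² + 2b²`, with Cauchy-Schwarz on the averaged difference. -/
lemma integral_sq_sum_div_sub_le_of_coupling {n : ℕ} (hn : 0 < n) {Z W : ℕ → Ω → ℝ} {m : ℝ}
    (hZ : ∀ j < n, MemLp (Z j) 2 μ) (hW : ∀ j < n, MemLp (W j) 2 μ) :
    ∫ ω, ((∑ j ∈ Finset.range n, W j ω) / n - m) ^ 2 ∂μ ≤
      2 / n * ∑ j ∈ Finset.range n, ∫ ω, (W j ω - Z j ω) ^ 2 ∂μ +
      2 * ∫ ω, ((∑ j ∈ Finset.range n, Z j ω) / n - m) ^ 2 ∂μ := by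
  have hn' : (0 : ℝ) < n := by exact_mod_cast hn
  have avg : ∀ {Y : ℕ → Ω → ℝ}, (∀ j < n, MemLp (Y j) 2 μ) →
      Integrable (fun ω => ((∑ j ∈ Finset.range n, Y j ω) / n - m) ^ 2) μ := by
    intro Y hY
    have h1 : MemLp (fun ω => ∑ j ∈ Finset.range n, Y j ω) 2 μ :=
      memLp_finsetSum _ fun j hj => hY j (Finset.mem_range.1 hj)
    have h2 : MemLp (fun ω => (∑ j ∈ Finset.range n, Y j ω) / n - m) 2 μ := by
      simp_rw [div_eq_inv_mul]
      exact (h1.const_mul _).sub (memLp_const m)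
    exact h2.integrable_sq
  have hd : ∀ j ∈ Finset.range n, Integrable (fun ω => (W j ω - Z j ω) ^ 2) μ := fun j hj =>
    ((hW j (Finset.mem_range.1 hj)).sub (hZ j (Finset.mem_range.1 hj))).integrable_sq
  rw [← integral_finsetSum _ hd, ← integral_const_mul, ← integral_const_mul,
    ← integral_add ((integrable_finsetSum _ hd).const_mul _) ((avg hZ).const_mul _)]
  refine integral_mono (avg hW) (((integrable_finsetSum _ hd).const_mul _).add
    ((avg hZ).const_mul _)) fun ω => ?_
  have hcs := sq_sum_le_card_mul_sum_sq (s := Finset.range n) (f := fun j => W j ω - Z j ω)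
  rw [Finset.card_range, Finset.sum_sub_distrib] at hcs
  simp only
  set w := ∑ j ∈ Finset.range n, W j ω
  set z := ∑ j ∈ Finset.range n, Z j ω
  set q := ∑ j ∈ Finset.range n, (W j ω - Z j ω) ^ 2
  have h1 : ((w - z) / n) ^ 2 ≤ q / n := by
    rw [div_pow, div_le_div_iff₀ (by positivity) hn']
    nlinarith
  have h2 : w / n - m = (w - z) / n + (z / n - m) := by ring
  have h3 : 2 / (n : ℝ) * q = 2 * (q / n) := by ring
  rw [h2, h3]
  nlinarith [sq_nonneg ((w - z) / n - (z / n - m))]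

end SquaredMeans

/-! ### The error for fixed indices -/

section FixedIndices

variable {d n : ℕ} {S V : Matrix (Fin d) (Fin d) ℝ} {κ : ℝ} {h : EuclideanSpace ℝ (Fin d) → ℝ}

lemma posSemidef_sub_mul_mul_transpose (hSt : Sᵀ = S) (hSV : S * S = V)
    {A : Matrix (Fin d) (Fin d) ℝ} (hA : (1 - A * Aᵀ).PosSemidef) :
    (V - S * A * (S * A)ᵀ).PosSemidef := by
  have := hA.mul_mul_conjTranspose_same S
  rw [Matrix.conjTranspose_eq_transpose_of_trivial, hSt] at this
  convert this using 1
  rw [Matrix.transpose_mul, hSt, mul_sub, sub_mul, mul_one, hSV]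
  simp only [Matrix.mul_assoc]

variable {ι : Type*} [Fintype ι] {e : ℕ → ι → ℝ} (i : ℕ → Fin d)

/-- By stationarity the difference is `S A Aᵀ S`. The chain from `0` thus satisfies the covariance
constraint of the Lipschitz condition. -/
lemma posSemidef_sub_noiseMatrix (hSt : Sᵀ = S) (hSV : S * S = V)
    (hS : ∀ c, S.col c ⬝ᵥ S.col c = 1) (he : ∀ j k, j < k → k < n → e j ⬝ᵥ e k = 0)
    (he1 : ∀ k, e k ⬝ᵥ e k = 1) {j : ℕ} (hj : j ≤ n) :
    (V - S * noiseMatrix S e i j * (S * noiseMatrix S e i j)ᵀ).PosSemidef := by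
  have h1 : segProd S i 0 j * (segProd S i 0 j)ᵀ + noiseMatrix S e i j * (noiseMatrix S e i j)ᵀ =
      1 := segProd_mul_transpose_add_noiseMatrix i hS he he1 j 0 hj
  have h2 := Matrix.posSemidef_self_mul_conjTranspose (S * segProd S i 0 j)
  convert h2 using 1
  rw [Matrix.conjTranspose_eq_transpose_of_trivial, Matrix.transpose_mul, Matrix.transpose_mul,
    hSt, sub_eq_iff_eq_add, ← hSV]
  calc S * S = S * (segProd S i 0 j * (segProd S i 0 j)ᵀ +
        noiseMatrix S e i j * (noiseMatrix S e i j)ᵀ) * S := by rw [h1, mul_one]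
    _ = _ := by simp only [Matrix.mul_add, Matrix.add_mul, Matrix.mul_assoc]

variable [DecidableEq ι]

/-- The mean square error for a fixed sequence of indices. -/
theorem integral_sq_average_le (hn : 0 < n) (hh : IsGaussianLipschitz κ 1 V h) (hSt : Sᵀ = S)
    (hSV : S * S = V) (hS : ∀ c, S.col c ⬝ᵥ S.col c = 1)
    (he : ∀ j k, j < k → k < n → e j ⬝ᵥ e k = 0) (he1 : ∀ k, e k ⬝ᵥ e k = 1) :
    ∫ x, ((∑ j ∈ Finset.range n, h ((S * noiseMatrix S e i j).euclideanCLM x)) / n -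
        ∫ x, h x ∂(multivariateGaussian 0 V)) ^ 2 ∂(stdGaussian (EuclideanSpace ℝ ι)) ≤
      κ ^ 2 * (2 / n * ∑ j ∈ Finset.range n,
          (S * (segProd S i 0 j * (segProd S i 0 j)ᵀ) * S).trace +
        2 / n ^ 2 * ∑ j ∈ Finset.range n, ∑ k ∈ Finset.range n,
          covBound S i (min j k) (max j k - min j k)) := by
  have hmeas := hh.measurable
  have hV : V.PosSemidef := by
    have := Matrix.posSemidef_self_mul_conjTranspose S
    rwa [Matrix.conjTranspose_eq_transpose_of_trivial, hSt, hSV] at this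
  set m := ∫ x, h x ∂(multivariateGaussian 0 V) with hm
  set N : ℕ → Matrix (Fin d) ι ℝ := noiseMatrix S e i
  set A : ℕ → Matrix (Fin d) (Fin d) ℝ := segProd S i 0 with hA
  -- An extra independent block carries the initial state: `X` ignores it and starts at `0`, `Y`
  -- starts from `N(0, V)`. Sharing the noise, they differ by `S A_j` applied to this block.
  let X : ℕ → Matrix (Fin d) (Fin d ⊕ ι) ℝ := fun j => Matrix.fromCols 0 (S * N j)
  let Y : ℕ → Matrix (Fin d) (Fin d ⊕ ι) ℝ := fun j => Matrix.fromCols (S * A j) (S * N j)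
  let pr : Matrix ι (Fin d ⊕ ι) ℝ := Matrix.fromCols 0 1
  have hpr : (stdGaussian (EuclideanSpace ℝ (Fin d ⊕ ι))).map pr.euclideanCLM =
      stdGaussian (EuclideanSpace ℝ ι) := by
    rw [map_euclideanCLM_stdGaussian]
    simp [pr, Matrix.transpose_fromCols, Matrix.fromCols_mul_fromRows]
  have hX : ∀ j w, (S * N j).euclideanCLM (pr.euclideanCLM w) = (X j).euclideanCLM w := by
    intro j w
    simp [X, pr, Matrix.euclideanCLM_apply]
  have hcross : ∀ j p, j + p ≤ n → Y (j + p) * (Y j)ᵀ = S * segProd S i j p * S := by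
    intro j p hjp
    simp only [Y, Matrix.transpose_fromCols, Matrix.fromCols_mul_fromRows,
      Matrix.transpose_mul, hSt]
    rw [← segProd_mul_transpose_add_noiseMatrix i hS he he1 j p hjp]
    simp only [Matrix.mul_add, Matrix.add_mul, Matrix.mul_assoc, A, N]
  have hYV : ∀ j ≤ n, Y j * (Y j)ᵀ = V := fun j hj => by
    have := hcross j 0 hj
    simpa [segProd, hSV] using this
  have hYp : ∀ j ≤ n, (V - Y j * (Y j)ᵀ).PosSemidef := fun j hj => by
    simpa [hYV j hj] using Matrix.PosSemidef.zero
  have hXp : ∀ j ≤ n, (V - X j * (X j)ᵀ).PosSemidef := fun j hj => by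
    have := posSemidef_sub_noiseMatrix i hSt hSV hS he he1 hj
    simpa [X, Matrix.transpose_fromCols, Matrix.fromCols_mul_fromRows] using this
  have hXY : ∀ j, (X j - Y j) * (X j - Y j)ᵀ = S * (A j * (A j)ᵀ) * S := by
    intro j
    have : X j - Y j = Matrix.fromCols (-(S * A j)) 0 := by
      ext a (b | b) <;> simp [X, Y]
    simp [this, Matrix.transpose_fromCols, Matrix.fromCols_mul_fromRows, Matrix.transpose_mul, hSt,
      Matrix.mul_assoc]
  have hcov : ∀ j p, j + p ≤ n →
      ∫ w, h ((Y j).euclideanCLM w) * h ((Y (j + p)).euclideanCLM w)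
        ∂(stdGaussian (EuclideanSpace ℝ (Fin d ⊕ ι))) - m ^ 2 ≤ κ ^ 2 * covBound S i j p := by
    intro j p hjp
    -- Cutting at `p / 2` gives the cross-covariance as `(S Pᵀ)(S Q)ᵀ`, so that both factors are
    -- small when `p` is large.
    set P := segProd S i j (p / 2) with hP
    set Q := segProd S i (j + p / 2) (p - p / 2) with hQ
    have hPQ : segProd S i j p = Q * P := by
      rw [hP, hQ, ← segProd_add]; congr 1; omega
    have hYY : Y j * (Y (j + p))ᵀ = S * Pᵀ * (S * Q)ᵀ := by
      have := congrArg Matrix.transpose (hcross j p hjp)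
      rw [hPQ] at this
      simp only [Matrix.transpose_mul, Matrix.transpose_transpose, hSt, Matrix.mul_assoc] at this ⊢
      exact this
    have hP1 : (1 - Pᵀ * Pᵀᵀ).PosSemidef := by
      simpa using posSemidef_one_sub_transpose_mul_segProd i hS j (p / 2)
    have := hh.integral_mul_sub_sq_le (hYV j (by omega)) (hYV (j + p) hjp)
      (posSemidef_sub_mul_mul_transpose hSt hSV hP1)
      (posSemidef_sub_mul_mul_transpose hSt hSV
        (posSemidef_one_sub_segProd_mul_transpose i hS (j + p / 2) (p - p / 2))) hYY
    convert this using 3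
    rw [covBound, ← hP, ← hQ]
    simp only [Matrix.transpose_mul, Matrix.transpose_transpose, hSt, Matrix.mul_assoc]
  have hcov' : ∀ j < n, ∀ k < n,
      ∫ w, h ((Y j).euclideanCLM w) * h ((Y k).euclideanCLM w)
        ∂(stdGaussian (EuclideanSpace ℝ (Fin d ⊕ ι))) - m ^ 2 ≤
          κ ^ 2 * covBound S i (min j k) (max j k - min j k) := by
    intro j hj k hk
    rcases le_total j k with hjk | hjk
    · have := hcov j (k - j) (by omega)
      rw [Nat.add_sub_cancel' hjk] at this
      simpa [hjk] using this
    · have := hcov k (j - k) (by omega)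
      rw [Nat.add_sub_cancel' hjk] at this
      simpa [hjk, mul_comm] using this
  have step1 : ∫ x, ((∑ j ∈ Finset.range n, h ((S * N j).euclideanCLM x)) / n - m) ^ 2
      ∂(stdGaussian (EuclideanSpace ℝ ι)) =
      ∫ w, ((∑ j ∈ Finset.range n, h ((X j).euclideanCLM w)) / n - m) ^ 2
        ∂(stdGaussian (EuclideanSpace ℝ (Fin d ⊕ ι))) := by
    rw [← hpr, integral_map (by fun_prop) (Measurable.aestronglyMeasurable (by fun_prop))]
    simp only [hX]
  have hYL : ∀ j < n, MemLp (fun w => h ((Y j).euclideanCLM w)) 2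
      (stdGaussian (EuclideanSpace ℝ (Fin d ⊕ ι))) := fun j hj => hh.memLp_two (hYp j hj.le)
  have step2 := integral_sq_sum_div_sub_le_of_coupling (m := m) hn hYL
    (W := fun j w => h ((X j).euclideanCLM w)) fun j hj => hh.memLp_two (hXp j hj.le)
  have step3 := integral_sq_sum_div_sub_le hn hYL
    (fun j hj => hh.integral_comp_euclideanCLM hV (hYV j hj.le)) hcov'
  have step4 : ∑ j ∈ Finset.range n, ∫ w, (h ((X j).euclideanCLM w) - h ((Y j).euclideanCLM w)) ^ 2
      ∂(stdGaussian (EuclideanSpace ℝ (Fin d ⊕ ι))) ≤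
      ∑ j ∈ Finset.range n, κ ^ 2 * (S * (A j * (A j)ᵀ) * S).trace := by
    refine Finset.sum_le_sum fun j hj => ?_
    have hj := (Finset.mem_range.1 hj).le
    rw [← hXY]
    exact (hh.integrable_and_integral_le (hXp j hj) (hYp j hj)).2
  rw [step1]
  refine step2.trans ?_
  simp only [← Finset.mul_sum] at step3 step4
  have h5 := mul_le_mul_of_nonneg_left step4 (show (0 : ℝ) ≤ 2 / n by positivity)
  calc _ ≤ 2 / n * (κ ^ 2 * ∑ j ∈ Finset.range n, (S * (A j * (A j)ᵀ) * S).trace) +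
        2 * (κ ^ 2 * (∑ j ∈ Finset.range n, ∑ k ∈ Finset.range n,
          covBound S i (min j k) (max j k - min j k)) / n ^ 2) := by linarith
    _ = _ := by ring

end FixedIndices

/-! ### The error averaged over all words of indices -/

lemma chain_congr {d : ℕ} (V : Matrix (Fin d) (Fin d) ℝ) {i i' : ℕ → Fin d} {g g' : ℕ → ℝ} {k : ℕ}
    (hi : ∀ j < k, i j = i' j) (hg : ∀ j < k, g j = g' j) : chain V i g k = chain V i' g' k := by
  induction k with
  | zero => rfl
  | succ k ih =>
    rw [chain, chain, ih (fun j hj => hi j (by omega)) fun j hj => hg j (by omega),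
      hi k (by omega), hg k (by omega)]

section AveragedBound

variable {d n : ℕ} [NeZero n] {S V : Matrix (Fin d) (Fin d) ℝ} {κ : ℝ}
  {h : EuclideanSpace ℝ (Fin d) → ℝ}

lemma sum_trace_segProd_mul_transpose (hd : d ≠ 0) {s m : ℕ} (hm : s + m ≤ n) :
    ∑ l : Fin n → Fin d, (S * (segProd S (fun k => l (Fin.ofNat n k)) s m *
      (segProd S (fun k => l (Fin.ofNat n k)) s m)ᵀ) * S).trace = d ^ n * meanEnergy S m := by
  rw [← Matrix.trace_sum, ← Finset.sum_mul, ← Finset.mul_sum, sum_segProd_mul_transpose hd hm]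
  simp [meanEnergy]

lemma sum_trace_transpose_mul_segProd (hd : d ≠ 0) {s m : ℕ} (hm : s + m ≤ n) :
    ∑ l : Fin n → Fin d, (S * ((segProd S (fun k => l (Fin.ofNat n k)) s m)ᵀ *
      segProd S (fun k => l (Fin.ofNat n k)) s m) * S).trace = d ^ n * meanEnergy S m := by
  rw [← Matrix.trace_sum, ← Finset.sum_mul, ← Finset.mul_sum, sum_transpose_mul_segProd hd hm]
  simp [meanEnergy]

lemma sum_covBound (hd : d ≠ 0) {s p : ℕ} (hp : s + p ≤ n) :
    ∑ l : Fin n → Fin d, covBound S (fun k => l (Fin.ofNat n k)) s p =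
      d ^ n * ((meanEnergy S (p / 2) + meanEnergy S (p - p / 2)) / 2) := by
  simp only [covBound]
  rw [← Finset.sum_div, Finset.sum_add_distrib, sum_trace_transpose_mul_segProd hd (by omega),
    sum_trace_segProd_mul_transpose hd (by omega)]
  ring

lemma sum_integral_sq_average_le (hh : IsGaussianLipschitz κ 1 V h) (hSt : Sᵀ = S)
    (hSV : S * S = V) (hS : ∀ c, S.col c ⬝ᵥ S.col c = 1) (hd : d ≠ 0) {ι : Type*} [Fintype ι]
    [DecidableEq ι] {e : ℕ → ι → ℝ} (he : ∀ j k, j < k → k < n → e j ⬝ᵥ e k = 0)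
    (he1 : ∀ k, e k ⬝ᵥ e k = 1) :
    ∑ l : Fin n → Fin d, ∫ x, ((∑ j ∈ Finset.range n,
          h ((S * noiseMatrix S e (fun k => l (Fin.ofNat n k)) j).euclideanCLM x)) / n -
        ∫ x, h x ∂(multivariateGaussian 0 V)) ^ 2 ∂(stdGaussian (EuclideanSpace ℝ ι)) ≤
      d ^ n * (10 * κ ^ 2 * ((d : ℝ) ^ 2 / n)) := by
  have hn : 0 < n := Nat.pos_of_neZero n
  have hn' : (0 : ℝ) < n := by exact_mod_cast hn
  refine (Finset.sum_le_sum fun l _ => integral_sq_average_le (fun k => l (Fin.ofNat n k)) hn hh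
    hSt hSV hS he he1).trans ?_
  have e1 : ∑ l : Fin n → Fin d, ∑ j ∈ Finset.range n,
      (S * (segProd S (fun k => l (Fin.ofNat n k)) 0 j *
        (segProd S (fun k => l (Fin.ofNat n k)) 0 j)ᵀ) * S).trace =
      d ^ n * ∑ j ∈ Finset.range n, meanEnergy S j := by
    rw [Finset.sum_comm, Finset.mul_sum]
    refine Finset.sum_congr rfl fun j hj => sum_trace_segProd_mul_transpose hd ?_
    have := Finset.mem_range.1 hj; omega
  have e2 : ∑ l : Fin n → Fin d, ∑ j ∈ Finset.range n, ∑ k ∈ Finset.range n,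
      covBound S (fun k => l (Fin.ofNat n k)) (min j k) (max j k - min j k) =
      d ^ n * ∑ j ∈ Finset.range n, ∑ k ∈ Finset.range n,
        (meanEnergy S ((max j k - min j k) / 2) +
          meanEnergy S ((max j k - min j k) - (max j k - min j k) / 2)) / 2 := by
    rw [Finset.sum_comm, Finset.mul_sum]
    refine Finset.sum_congr rfl fun j hj => ?_
    rw [Finset.sum_comm, Finset.mul_sum]
    refine Finset.sum_congr rfl fun k hk => sum_covBound hd ?_
    have := Finset.mem_range.1 hj; have := Finset.mem_range.1 hk; omega
  rw [← Finset.mul_sum, Finset.sum_add_distrib, ← Finset.mul_sum, ← Finset.mul_sum, e1, e2]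
  have b1 := sum_meanEnergy_le hd hSt hS n
  -- For each of the `n` rows: one factor `2` for the two sides of `j`, another for the halved lags.
  have b2 : ∑ j ∈ Finset.range n, ∑ k ∈ Finset.range n,
        (meanEnergy S ((max j k - min j k) / 2) +
          meanEnergy S ((max j k - min j k) - (max j k - min j k) / 2)) / 2 ≤
      n * (2 * (2 * (d : ℝ) ^ 2)) := by
    have := Finset.sum_le_card_nsmul (Finset.range n) (fun j => ∑ k ∈ Finset.range n,
        (meanEnergy S ((max j k - min j k) / 2) +
          meanEnergy S ((max j k - min j k) - (max j k - min j k) / 2)) / 2)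
      (2 * (2 * (d : ℝ) ^ 2)) fun j hj => sum_range_dist_le
        (F := fun p => (meanEnergy S (p / 2) + meanEnergy S (p - p / 2)) / 2) (fun p => by
          have := meanEnergy_nonneg (S := S) hSt (p / 2)
          have := meanEnergy_nonneg (S := S) hSt (p - p / 2)
          positivity) (sum_meanEnergy_half_le hd hSt hS n) (Finset.mem_range.1 hj)
    simpa using this
  set a := ∑ j ∈ Finset.range n, meanEnergy S j
  set b := ∑ j ∈ Finset.range n, ∑ k ∈ Finset.range n,
        (meanEnergy S ((max j k - min j k) / 2) +
          meanEnergy S ((max j k - min j k) - (max j k - min j k) / 2)) / 2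
  calc κ ^ 2 * (2 / n * (d ^ n * a) + 2 / n ^ 2 * (d ^ n * b))
      ≤ κ ^ 2 * (2 / n * (d ^ n * (d : ℝ) ^ 2) +
          2 / n ^ 2 * (d ^ n * (n * (2 * (2 * (d : ℝ) ^ 2))))) := by gcongr
    _ = _ := by field_simp; ring

end AveragedBound

/-! ### Random indices independent of the noise -/

section Randomization

variable {Ω : Type*} [MeasurableSpace Ω] {P : Measure Ω} [IsProbabilityMeasure P]

/-- Integrating a function of a variable with finitely many values and an independent variable. -/
lemma integrable_and_integral_eq_sum {α E : Type*} [Fintype α] [MeasurableSpace α]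
    [MeasurableSingletonClass α] [MeasurableSpace E] {I : Ω → α} {G : Ω → E} {μ : Measure E}
    (hI : Measurable I) (hG : Measurable G) (hIG : IndepFun I G P) (hμ : P.map G = μ)
    {F : α → E → ℝ} (hF : ∀ l, Measurable (F l)) (hFi : ∀ l, Integrable (F l) μ) :
    Integrable (fun ω => F (I ω) (G ω)) P ∧
      ∫ ω, F (I ω) (G ω) ∂P = ∑ l, P.real (I ⁻¹' {l}) * ∫ x, F l x ∂μ := by
  classical
  have hdec : ∀ ω, F (I ω) (G ω) =
      ∑ l, ({l} : Set α).indicator (fun _ => (1 : ℝ)) (I ω) * F l (G ω) := by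
    intro ω
    rw [Finset.sum_eq_single (I ω)]
    · simp
    · intro l _ hl
      simp [Set.indicator, Ne.symm hl]
    · simp
  have hind : ∀ l, Measurable (({l} : Set α).indicator fun _ => (1 : ℝ)) := fun l =>
    measurable_const.indicator (measurableSet_singleton l)
  have hindi : ∀ l, Integrable (fun ω => ({l} : Set α).indicator (fun _ => (1 : ℝ)) (I ω)) P := by
    intro l
    have : (fun ω => ({l} : Set α).indicator (fun _ => (1 : ℝ)) (I ω)) =
      (I ⁻¹' {l}).indicator fun _ => (1 : ℝ) := rfl
    rw [this]
    exact (integrable_const _).indicator (hI (measurableSet_singleton l))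
  have hFG : ∀ l, Integrable (fun ω => F l (G ω)) P := by
    intro l
    have := hFi l
    rw [← hμ] at this
    exact this.comp_measurable hG
  have hindep : ∀ l, IndepFun (fun ω => ({l} : Set α).indicator (fun _ => (1 : ℝ)) (I ω))
      (fun ω => F l (G ω)) P := fun l => hIG.comp (hind l) (hF l)
  have hint : ∀ l, Integrable
      (fun ω => ({l} : Set α).indicator (fun _ => (1 : ℝ)) (I ω) * F l (G ω)) P := fun l =>
    (hindep l).integrable_mul (hindi l) (hFG l)
  simp_rw [hdec]
  refine ⟨integrable_finsetSum _ fun l _ => hint l, ?_⟩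
  rw [integral_finsetSum _ fun l _ => hint l]
  refine Finset.sum_congr rfl fun l _ => ?_
  rw [(hindep l).integral_fun_mul_eq_mul_integral (hindi l).aestronglyMeasurable
    (hFG l).aestronglyMeasurable]
  congr 1
  · have : (fun ω => ({l} : Set α).indicator (fun _ => (1 : ℝ)) (I ω)) =
      (I ⁻¹' {l}).indicator fun _ => (1 : ℝ) := rfl
    rw [this, integral_indicator (hI (measurableSet_singleton l))]
    simp
  · rw [← hμ, integral_map hG.aemeasurable (hF l).aestronglyMeasurable]

lemma measureReal_preimage_singleton_of_uniform {d n : ℕ} {I : Fin n → Ω → Fin d}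
    (hI : ∀ k, Measurable (I k)) (hindep : iIndepFun I P)
    (hunif : ∀ k, P.map (I k) = uniformOn Set.univ) (l : Fin n → Fin d) :
    P.real ((fun ω k => I k ω) ⁻¹' {l}) = ((d : ℝ) ^ n)⁻¹ := by
  have h1 := (iIndepFun_iff_map_fun_eq_pi_map fun k => (hI k).aemeasurable).1 hindep
  rw [measureReal_def, ← Measure.map_apply (by fun_prop) (measurableSet_singleton l), h1,
    Measure.pi_singleton]
  simp [hunif, uniformOn_univ]

end Randomization

theorem mainTheorem2 {d n : ℕ} (hn : 0 < n)
    (V : Matrix (Fin d) (Fin d) ℝ) (hV : V.PosSemidef) (hdiag : ∀ k, V k k = 1)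
    (κ : ℝ) (h : EuclideanSpace ℝ (Fin d) → ℝ) (hh : IsGaussianLipschitz κ 1 V h)
    {Ω : Type*} [MeasurableSpace Ω] (P : Measure Ω) [IsProbabilityMeasure P]
    (i : ℕ → Ω → Fin d) (g : ℕ → Ω → ℝ)
    (hi_meas : ∀ k, Measurable (i k)) (hg_meas : ∀ k, Measurable (g k))
    (hi_indep : iIndepFun (fun k : Fin n => i k) P)
    (hi_unif : ∀ k < n, P.map (i k) = uniformOn Set.univ)
    (hg_indep : iIndepFun g P)
    (hg_law : ∀ k, P.map (g k) = gaussianReal 0 1)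
    (hig : IndepFun (fun ω k => i k ω) (fun ω k => g k ω) P) :
    Integrable h (multivariateGaussian 0 V) ∧
    Integrable (fun ω =>
      ((∑ j ∈ Finset.range n, h (chain V (fun k => i k ω) (fun k => g k ω) j)) / n
        - ∫ x, h x ∂(multivariateGaussian 0 V)) ^ 2) P ∧
    ∫ ω, ((∑ j ∈ Finset.range n, h (chain V (fun k => i k ω) (fun k => g k ω) j)) / n
        - ∫ x, h x ∂(multivariateGaussian 0 V)) ^ 2 ∂P
      ≤ 18 * κ ^ 2 * ((d : ℝ) ^ 2 / n) := by
  have hmeas := hh.measurable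
  have : NeZero n := ⟨hn.ne'⟩
  -- A probability space is nonempty, and an index in `Fin d` exists at any of its points.
  have hd : d ≠ 0 := by
    obtain ⟨ω⟩ := P.nonempty_of_neZero
    exact (Fin.pos (i 0 ω)).ne'
  obtain ⟨S, hSt, hSV⟩ := hV.exists_transpose_eq_self_mul_self_eq
  have hS : ∀ c, S.col c ⬝ᵥ S.col c = 1 := by
    intro c
    have h1 : S.col c = S c := congrFun hSt c
    rw [← hdiag c, ← hSV, Matrix.mul_apply]
    nth_rewrite 1 [h1]
    rfl
  set m := ∫ x, h x ∂(multivariateGaussian 0 V) with hm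
  -- Times are read modulo `n`, which is harmless: the states `X_0, …, X_{n-1}` only use indices and
  -- noise at times below `n`, where the directions are orthonormal.
  let e : ℕ → Fin n → ℝ := fun k => Pi.single (Fin.ofNat n k) 1
  have he : ∀ j k, j < k → k < n → e j ⬝ᵥ e k = 0 := by
    intro j k hjk hk
    have : Fin.ofNat n j ≠ Fin.ofNat n k := by
      rw [Ne, Fin.ext_iff, Fin.val_ofNat, Fin.val_ofNat, Nat.mod_eq_of_lt hk,
        Nat.mod_eq_of_lt (hjk.trans hk)]
      exact hjk.ne
    rw [single_dotProduct, one_mul]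
    exact Pi.single_eq_of_ne this _
  have he1 : ∀ k, e k ⬝ᵥ e k = 1 := fun k => by simp [e]
  let F : (Fin n → Fin d) → EuclideanSpace ℝ (Fin n) → ℝ := fun l x =>
    ((∑ j ∈ Finset.range n,
      h ((S * noiseMatrix S e (fun k => l (Fin.ofNat n k)) j).euclideanCLM x)) / n - m) ^ 2
  let I : Ω → Fin n → Fin d := fun ω k => i k ω
  let G : Ω → EuclideanSpace ℝ (Fin n) := fun ω => WithLp.toLp 2 fun k : Fin n => g k ω
  have hI : Measurable I := by fun_prop
  have hG : Measurable G := by fun_prop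
  have hIG : IndepFun I G P := by
    have hφ : Measurable fun (a : ℕ → Fin d) (k : Fin n) => a k := by fun_prop
    have hψ : Measurable fun a : ℕ → ℝ =>
      (WithLp.toLp 2 fun k : Fin n => a k : EuclideanSpace ℝ (Fin n)) := by fun_prop
    exact hig.comp hφ hψ
  have hGlaw : P.map G = stdGaussian (EuclideanSpace ℝ (Fin n)) := by
    have h1 := hg_indep.precomp (g := fun k : Fin n => (k : ℕ)) Fin.val_injective
    have h2 := (iIndepFun_iff_map_fun_eq_pi_map fun k : Fin n => (hg_meas k).aemeasurable).1 h1
    simp only [hg_law] at h2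
    rw [← map_pi_eq_stdGaussian, ← h2, Measure.map_map (by fun_prop) (by fun_prop)]
    rfl
  have hF : ∀ l, Measurable (F l) := fun l => by fun_prop
  have hFi : ∀ l, Integrable (F l) (stdGaussian (EuclideanSpace ℝ (Fin n))) := by
    intro l
    have h1 : MemLp (fun x => ∑ j ∈ Finset.range n,
        h ((S * noiseMatrix S e (fun k => l (Fin.ofNat n k)) j).euclideanCLM x)) 2
        (stdGaussian (EuclideanSpace ℝ (Fin n))) :=
      memLp_finsetSum _ fun j hj => hh.memLp_two
        (posSemidef_sub_noiseMatrix _ hSt hSV hS he he1 (Finset.mem_range.1 hj).le)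
    have h2 : MemLp (fun x => (∑ j ∈ Finset.range n,
        h ((S * noiseMatrix S e (fun k => l (Fin.ofNat n k)) j).euclideanCLM x)) / n - m) 2
        (stdGaussian (EuclideanSpace ℝ (Fin n))) := by
      simp_rw [div_eq_inv_mul]
      exact (h1.const_mul _).sub (memLp_const m)
    exact h2.integrable_sq
  have hchain : ∀ ω, ((∑ j ∈ Finset.range n,
      h (chain V (fun k => i k ω) (fun k => g k ω) j)) / n - m) ^ 2 = F (I ω) (G ω) := by
    intro ω
    simp only [F]
    congr 3
    refine Finset.sum_congr rfl fun j hj => ?_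
    have hmod : ∀ k < j, ((Fin.ofNat n k : Fin n) : ℕ) = k := fun k hk => by
      rw [Fin.val_ofNat, Nat.mod_eq_of_lt (hk.trans (Finset.mem_range.1 hj))]
    rw [← chain_eq_euclideanCLM (fun k => I ω (Fin.ofNat n k)) hSt hSV
      (fun k => g (Fin.ofNat n k : Fin n) ω) (G ω) (fun k => by simp [e, G]) j]
    congr 1
    exact chain_congr V (fun k hk => by simp only [I, hmod k hk])
      fun k hk => by simp only [hmod k hk]
  obtain ⟨h1, h2⟩ := integrable_and_integral_eq_sum hI hG hIG hGlaw hF hFi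
  simp_rw [hchain]
  refine ⟨hh.integrable_multivariateGaussian hV (M := S) (by rw [hSt, hSV]), h1, ?_⟩
  have hP : ∀ l, P.real (I ⁻¹' {l}) = ((d : ℝ) ^ n)⁻¹ :=
    measureReal_preimage_singleton_of_uniform (fun k => hi_meas k) hi_indep
      fun k => hi_unif k k.2
  simp only [hP] at h2
  rw [h2, ← Finset.mul_sum]
  have h3 := sum_integral_sq_average_le (n := n) hh hSt hSV hS hd he he1
  have hdn : (0 : ℝ) < (d : ℝ) ^ n := by positivity
  rw [inv_mul_le_iff₀ hdn]
  refine h3.trans ?_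
  gcongr
  norm_num
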